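/- Let $\mathrm{Top}$ be one of the following three categories: all topological spaces; compactly generated spaces (those with the final topology with respect to continuous maps from compact Hausdorff spaces); $\Delta$-generated spaces (those with the final topology with respect to continuous maps from simplices). In the latter two cases, subspaces, products and mapping spaces formed in $\mathrm{Top}$ carry the coreflection into $\mathrm{Top}$ of the usual topology. Let $P$ be a partially ordered set with the Alexandrov topology, in which the closed sets are the downward closed sets. Let $X \in \mathrm{Top}$ be a $P$-stratified space, that is, equipped with a continuous map $s\colon X\to P$. For $p \in P$ write $X_p=s^{-1}(p)$ and $X_{\le p}=\{x\in X \mid s(x)\le p\}$. Let $\mathcal I=[p_0<\dots<p_n]$ be a regular flag in $P$ (a finite nonempty strictly increasing sequence). Let $|\Delta^{\mathcal I}|$ be the standard $n$-simplex, stratified by $u\mapsto \max\{p_i \mid u_i>0\}$, let $v_n$ be its last vertex, and for $p\in\mathcal I$ let $|\Delta^{\mathcal I_{\ge p}}|$ be the face spanned by the vertices of index $i$ with $p_i\ge p$. A map between $P$-stratified spaces is stratum-preserving if it is continuous and commutes with the maps to $P$; a product $T\times|\Delta^{\mathcal I}|$ with a space $T$ is stratified through the second factor. The homotopy link $\mathrm{HoLink}_{\mathcal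 I}(X)$ is the set of stratum-preserving maps $|\Delta^{\mathcal I}|\to X$ with the topology induced by the compact-open topology (coreflected into $\mathrm{Top}$). Suppose that $X$ admits an almost stratum-preserving $\mathcal I$-retraction (aspire), that is, there is a stratum-preserving map $R\colon X_{p_n}\times|\Delta^{\mathcal I}|\to X$ such that for every $p\in\mathcal I$ the map of general topological spaces $$(X_{p_n}\cup X_{\le p})\times|\Delta^{\mathcal I_{\ge p}}|\to X,\qquad (x,u)\mapsto\begin{cases}R(x,u) & s(x)=p_n\\ x & s(x)\le p\end{cases}$$ is well defined and continuous, where $X_{p_n}\cup X_{\le p}\subset X$ carries the ordinary relative topology. Then the evaluation map $$\mathrm{ev}\colon \mathrm{HoLink}_{\mathcal I}(X)\to X_{p_n},\qquad \sigma\mapsto\sigma(v_n),$$ is a weak homotopy equivalence. -/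

import Mathlib

open Topology

universe u v

namespace HoLinks

/-! ### Categories of topological spaces -/

/-- The three admissible categories of topological spaces: all (general) topological spaces,
compactly generated spaces, and `Δ`-generated spaces. -/
inductive TopCategory
  | general
  | compactlyGenerated
  | deltaGenerated

namespace TopCategory

/-- The space `X` is an object of the category `c`. -/
def IsObject (c : TopCategory) (X : Type u) [TopologicalSpace X] : Prop :=
  match c with
  | general => True
  | compactlyGenerated => CompactlyGeneratedSpace X
  | deltaGenerated => DeltaGeneratedSpace X

/-- The coreflection of a topology into the category `c`: nothing changes for general spaces;
otherwise the final topology with respect to all continuous maps from compact Hausdorff spaces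
(respectively from the spaces `ℝᵐ`, equivalently from simplices). -/
abbrev topology (c : TopCategory) (X : Type u) [t : TopologicalSpace X] : TopologicalSpace X :=
  match c with
  | general => t
  | compactlyGenerated => TopologicalSpace.compactlyGenerated.{u} X
  | deltaGenerated => TopologicalSpace.generatedBy (fun m : ℕ => Fin m → ℝ) (Y := X)

/-- The set `X`, with its topology replaced by the coreflection into the category `c`. -/
def Space (_c : TopCategory) (X : Type u) : Type u := X

instance (c : TopCategory) (X : Type u) [TopologicalSpace X] : TopologicalSpace (c.Space X) :=
  c.topology X

theorem continuous_topology (c : TopCategory) {X Y : Type u} [tX : TopologicalSpace X]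
    [tY : TopologicalSpace Y] (f : C(X, Y)) :
    Continuous[c.topology X, c.topology Y] f := by
  cases c with
  | general => exact f.continuous
  | compactlyGenerated =>
    rw [continuous_iff_coinduced_le]
    intro U hU
    have hU' := isOpen_sigma_iff.1 (isOpen_coinduced.1 hU)
    refine isOpen_coinduced.2 (isOpen_coinduced.2 (isOpen_sigma_iff.2 fun i => ?_))
    exact hU' ⟨i.1, f.comp i.2⟩
  | deltaGenerated =>
    rw [continuous_iff_coinduced_le]
    simp only [topology, TopologicalSpace.generatedBy, coinduced_iSup, coinduced_compose]
    exact iSup₂_le fun i g => le_iSup₂_of_le i (f.comp g) le_rfl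

/-- The continuous map between coreflections induced by a continuous map. -/
def map (c : TopCategory) {X Y : Type u} [TopologicalSpace X] [TopologicalSpace Y]
    (f : C(X, Y)) : C(c.Space X, c.Space Y) :=
  @ContinuousMap.mk (c.Space X) (c.Space Y) _ _ f (c.continuous_topology f)

end TopCategory

/-! ### Weak homotopy equivalences -/

section WeakEquivalence

variable {X Y : Type u} [TopologicalSpace X] [TopologicalSpace Y]

/-- The map induced on sets of path components. -/
def piZeroMap (f : C(X, Y)) : ZerothHomotopy X → ZerothHomotopy Y :=
  Quotient.map f fun _ _ h => h.map f.continuous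

/-- The map `π_m(X, x) → π_m(Y, f x)` induced by `f`. -/
def piMap (m : ℕ) (f : C(X, Y)) (x : X) :
    HomotopyGroup (Fin m) X x → HomotopyGroup (Fin m) Y (f x) :=
  Quotient.map
    (fun γ => (⟨f.comp γ.1, fun y hy => congrArg f (γ.2 y hy)⟩ : GenLoop (Fin m) Y (f x)))
    (fun _ _ h => ContinuousMap.HomotopicRel.comp_continuousMap h f)

/-- `f` is a weak homotopy equivalence: it induces a bijection on path components, and
isomorphisms on all homotopy groups at all base points. -/
def IsWeakHomotopyEquiv (f : C(X, Y)) : Prop :=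
  Function.Bijective (piZeroMap f) ∧
    ∀ (m : ℕ) (x : X), Function.Bijective (piMap (m + 1) f x)

end WeakEquivalence

/-! ### Stratified simplices -/

/-- The topological standard simplex `|Δⁿ|`. -/
abbrev Simplex (n : ℕ) : Type := stdSimplex ℝ (Fin (n + 1))

theorem Simplex.support_nonempty {n : ℕ} (w : Simplex n) :
    (Finset.univ.filter fun i => 0 < w.1 i).Nonempty := by
  by_contra h
  rw [Finset.not_nonempty_iff_eq_empty, Finset.filter_eq_empty_iff] at h
  have h0 : ∑ i, w.1 i ≤ 0 := Finset.sum_nonpos fun i hi => not_lt.1 (h hi)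
  have h1 := w.2.2
  linarith

/-- The largest index with positive barycentric coordinate. -/
noncomputable def Simplex.topIndex {n : ℕ} (w : Simplex n) : Fin (n + 1) :=
  (Finset.univ.filter fun i => 0 < w.1 i).max' w.support_nonempty

/-- The top vertex `v_n`. -/
def Simplex.topVertex (n : ℕ) : Simplex n :=
  ⟨Pi.single (Fin.last n) 1, single_mem_stdSimplex ℝ (Fin.last n)⟩

theorem Simplex.topIndex_topVertex (n : ℕ) : (topVertex n).topIndex = Fin.last n := by
  refine le_antisymm (Fin.le_last _) (Finset.le_max' _ _ ?_)
  rw [Finset.mem_filter]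
  exact ⟨Finset.mem_univ _, by simp [topVertex]⟩

variable {P : Type v} [PartialOrder P]

/-- For a regular flag `I = [p₀ < ⋯ < pₙ]` of `P`, the stratification of `|Δⁿ|` that defines the
stratified simplex `|Δ^I|`: a point lies in the stratum of the largest `pᵢ` such that its `i`-th
barycentric coordinate is positive. The poset `P` carries the Alexandrov topology whose open sets
are the upper sets. -/
noncomputable def simplexStrat {n : ℕ} (I : Fin (n + 1) ↪o P) : C(Simplex n, WithUpperSet P) where
  toFun w := WithUpperSet.toUpperSet (I w.topIndex)
  continuous_toFun := by
    refine continuous_def.2 fun U hU => ?_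
    have hU' : IsUpperSet U := IsUpperSet.isOpen_iff_isUpperSet.1 hU
    have key : (fun w : Simplex n => WithUpperSet.toUpperSet (I w.topIndex)) ⁻¹' U =
        ⋃ i : Fin (n + 1), ⋃ _ : WithUpperSet.toUpperSet (I i) ∈ U,
          {w : Simplex n | 0 < w.1 i} := by
      ext w
      simp only [Set.mem_preimage, Set.mem_iUnion, Set.mem_ofPred_eq, exists_prop]
      constructor
      · intro h
        exact ⟨w.topIndex, h, (Finset.mem_filter.1 (Finset.max'_mem _ w.support_nonempty)).2⟩
      · rintro ⟨i, hi, hw⟩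
        refine hU' ?_ hi
        exact I.monotone (Finset.le_max' _ i (by simpa using hw))
    rw [key]
    exact isOpen_iUnion fun i => isOpen_iUnion fun _ =>
      isOpen_lt continuous_const ((continuous_apply i).comp continuous_subtype_val)

/-- The face `|Δ^{I_{≥ p_k}}|` of `|Δ^I|`, spanned by the vertices with index at least `k`. -/
abbrev UpperFace (n : ℕ) (k : Fin (n + 1)) : Type :=
  {w : Simplex n // ∀ i, i < k → w.1 i = 0}

/-! ### Strata, homotopy links and almost stratum-preserving retractions

A `P`-stratified space is a space `X` with a continuous map `s : X → P`, where `P` carries the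
Alexandrov topology. -/

variable {X : Type u} [TopologicalSpace X]

/-- The stratum `X_p`, as an object of the category `c`. -/
abbrev Stratum (c : TopCategory) (s : C(X, WithUpperSet P)) (p : P) : Type u :=
  c.Space {x : X // s x = WithUpperSet.toUpperSet p}

/-- The `I`-th homotopy link of `X`: the space of stratum-preserving maps `|Δ^I| → X`, with the
topology induced by the compact-open topology, as an object of the category `c`. -/
abbrev HoLink (c : TopCategory) (s : C(X, WithUpperSet P)) {n : ℕ} (I : Fin (n + 1) ↪o P) :
    Type u :=
  c.Space {σ : C(Simplex n, X) // ∀ w, s (σ w) = simplexStrat I w}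

theorem strat_topVertex (s : C(X, WithUpperSet P)) {n : ℕ} (I : Fin (n + 1) ↪o P)
    (σ : {σ : C(Simplex n, X) // ∀ w, s (σ w) = simplexStrat I w}) :
    s (σ.1 (Simplex.topVertex n)) = WithUpperSet.toUpperSet (I (Fin.last n)) :=
  (σ.2 _).trans (congrArg (fun i => WithUpperSet.toUpperSet (I i)) (Simplex.topIndex_topVertex n))

theorem continuous_evalTopVertex (s : C(X, WithUpperSet P)) {n : ℕ} (I : Fin (n + 1) ↪o P) :
    Continuous fun σ : {σ : C(Simplex n, X) // ∀ w, s (σ w) = simplexStrat I w} =>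
      (⟨σ.1 (Simplex.topVertex n), strat_topVertex s I σ⟩ :
        {x : X // s x = WithUpperSet.toUpperSet (I (Fin.last n))}) :=
  ((continuous_eval_const (Simplex.topVertex n)).comp continuous_subtype_val).subtype_mk _

/-- Evaluation at the top vertex, `σ ↦ σ(v_n)`. -/
def HoLink.ev (c : TopCategory) (s : C(X, WithUpperSet P)) {n : ℕ} (I : Fin (n + 1) ↪o P) :
    C(HoLink c s I, Stratum c s (I (Fin.last n))) :=
  c.map ⟨fun σ => ⟨σ.1 (Simplex.topVertex n), strat_topVertex s I σ⟩,
    continuous_evalTopVertex s I⟩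

/-- The product `X_{pₙ} × |Δ^I|`, formed in the category `c`. -/
abbrev StratumProdSimplex (c : TopCategory) (s : C(X, WithUpperSet P)) {n : ℕ}
    (I : Fin (n + 1) ↪o P) : Type u :=
  c.Space (Stratum c s (I (Fin.last n)) × Simplex n)

/-- The subspace `X_{pₙ} ∪ X_{≤ p_k}` of `X`, with the relative topology. -/
abbrev TopOrBelow (s : C(X, WithUpperSet P)) {n : ℕ} (I : Fin (n + 1) ↪o P)
    (k : Fin (n + 1)) : Type u :=
  {x : X // s x = WithUpperSet.toUpperSet (I (Fin.last n)) ∨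
    s x ≤ WithUpperSet.toUpperSet (I k)}

/-- `R : X_{pₙ} × |Δ^I| → X` is an almost stratum-preserving `I`-retraction: it is
stratum-preserving (the product being stratified through its second factor) and, for every `k`,
the assignment `(x, w) ↦ R(x, w)` if `s(x) = pₙ` and `(x, w) ↦ x` if `s(x) ≤ p_k` is a
well-defined continuous map `(X_{pₙ} ∪ X_{≤ p_k}) × |Δ^{I_{≥ p_k}}| → X` of general
topological spaces. -/
structure IsAspire (c : TopCategory) (s : C(X, WithUpperSet P)) {n : ℕ}
    (I : Fin (n + 1) ↪o P) (R : C(StratumProdSimplex c s I, X)) : Prop where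
  stratum_preserving : ∀ (x : Stratum c s (I (Fin.last n))) (w : Simplex n),
    s (R (x, w)) = simplexStrat I w
  extends_continuously : ∀ k : Fin (n + 1),
    ∃ F : C(TopOrBelow s I k × UpperFace n k, X),
      (∀ (x : TopOrBelow s I k) (w : UpperFace n k)
        (hx : s x.1 = WithUpperSet.toUpperSet (I (Fin.last n))),
        F (x, w) = R ((⟨x.1, hx⟩ : {y : X // s y = WithUpperSet.toUpperSet (I (Fin.last n))}),
          w.1)) ∧
      (∀ (x : TopOrBelow s I k) (w : UpperFace n k),
        s x.1 ≤ WithUpperSet.toUpperSet (I k) → F (x, w) = x.1)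

/-- The stratified space `(X, s)` admits an almost stratum-preserving `I`-retraction. -/
def AdmitsAspire (c : TopCategory) (s : C(X, WithUpperSet P)) {n : ℕ}
    (I : Fin (n + 1) ↪o P) : Prop :=
  ∃ R : C(StratumProdSimplex c s I, X), IsAspire c s I R

end HoLinks

/-! For the uncoreflected topologies, `ev` has the section `x ↦ R(x, ·)`, and section after `ev` is
homotopic to the identity by a homotopy over `X_{pₙ}` (`homotopicWith_section_comp_ev`). This
homotopy runs through the maps `w ↦ R(σ(α_k w), β_k w)`, where `α_k` is induced by `collapse k` and
`β_k` by `i ↦ max i k`. For `k = n` this is `σ`, for `k = 0` it is `R(σ(vₙ), w)`. From `k + 1` to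
`k`, first `β` moves along a segment, then `α` does. The aspire extension at `p_k` makes both moves
continuous.

Coreflection keeps weak equivalences visible because a continuous map from a cube or a cylinder over
a cube is also continuous into the coreflection (`continuous_to_space`). The homotopy may move base
points, so homotopy groups are treated by relative lifting over balls (`exists_lift_expand`): the
fibrewise homotopy, run in a collar, joins a prescribed lift on the sphere to the section inside. -/

namespace HoLinks

/-! ### Spaces homeomorphic to the unit ball of a normed space -/

/-- A presentation of `D` as the closed unit ball of the normed space `V`, as a retract of `V`. -/
structure BallModel (D V : Type*) [TopologicalSpace D] [NormedAddCommGroup V]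
    [NormedSpace ℝ V] where
  toBall : C(D, V)
  ret : C(V, D)
  ret_toBall : ∀ x, ret (toBall x) = x
  norm_toBall_le : ∀ x, ‖toBall x‖ ≤ 1
  toBall_ret : ∀ y, ‖y‖ ≤ 1 → toBall (ret y) = y

namespace BallModel

section

variable {D V : Type*} [TopologicalSpace D] [NormedAddCommGroup V] [NormedSpace ℝ V]
  (M : BallModel D V)

/-- The points of `D` that correspond to the unit sphere. -/
def sphere : Set D := {x | ‖M.toBall x‖ = 1}

theorem isClosed_sphere : IsClosed M.sphere :=
  isClosed_eq (by fun_prop) continuous_const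

/-- The radial expansion by the factor `(1 - t / 2)⁻¹`, cut off at the unit sphere. -/
noncomputable def expand : C(unitInterval × D, D) where
  toFun x := M.ret ((max (1 - (x.1 : ℝ) / 2) ‖M.toBall x.2‖)⁻¹ • M.toBall x.2)
  continuous_toFun := by
    refine M.ret.continuous.comp (Continuous.smul (Continuous.inv₀ (by fun_prop) fun x => ?_)
      (by fun_prop))
    have := x.1.2.2
    exact (lt_max_of_lt_left (by linarith)).ne'

theorem expand_zero (x : D) : M.expand (0, x) = x := by
  simp [expand, M.norm_toBall_le x, M.ret_toBall]

theorem expand_of_mem_sphere (t : unitInterval) {x : D} (hx : x ∈ M.sphere) :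
    M.expand (t, x) = x := by
  have h : ‖M.toBall x‖ = 1 := hx
  have := t.2.1
  have h' : 1 - (t : ℝ) / 2 ≤ 1 := by linarith
  simp [expand, h, h', M.ret_toBall]

/-- At time `1` the divisor is `max (1 / 2) ‖x‖`, so the outer shell is normalised onto the sphere
while the inner ball is doubled. -/
theorem expand_one_mem_sphere {x : D} (hx : 1 / 2 ≤ ‖M.toBall x‖) :
    M.expand (1, x) ∈ M.sphere := by
  have h0 : ‖M.toBall x‖ ≠ 0 := by linarith
  have h : ‖(max (1 - ((1 : unitInterval) : ℝ) / 2) ‖M.toBall x‖)⁻¹ • M.toBall x‖ = 1 := by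
    rw [max_eq_right (by norm_num at hx ⊢; linarith), norm_smul, norm_inv, norm_norm,
      inv_mul_cancel₀ h0]
  change ‖M.toBall (M.ret _)‖ = 1
  rw [M.toBall_ret _ h.le, h]

/-- The function which vanishes on the sphere and is `1` on the ball of radius `1 / 2`. -/
noncomputable def collar : C(D, unitInterval) where
  toFun x := Set.projIcc 0 1 zero_le_one (2 * (1 - ‖M.toBall x‖))
  continuous_toFun := continuous_projIcc.comp (by fun_prop)

theorem collar_of_mem_sphere {x : D} (hx : x ∈ M.sphere) : M.collar x = 0 := by
  have h : ‖M.toBall x‖ = 1 := hx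
  simp [collar, h]

theorem collar_eq_one {x : D} (hx : ‖M.toBall x‖ ≤ 1 / 2) : M.collar x = 1 :=
  Set.projIcc_of_right_le zero_le_one (by linarith)

end

/-- The unit interval as the unit ball of `ℝ`. -/
noncomputable def unitInterval : BallModel unitInterval ℝ where
  toBall := ⟨fun x => 2 * x - 1, by fun_prop⟩
  ret := ⟨fun y => Set.projIcc 0 1 zero_le_one ((y + 1) / 2), continuous_projIcc.comp (by fun_prop)⟩
  ret_toBall x := by
    have : ((2 * (x : ℝ) - 1) + 1) / 2 = x := by ring
    simp only [ContinuousMap.coe_mk, this, Set.projIcc_val]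
  norm_toBall_le x := by
    have := x.2.1
    have := x.2.2
    simp only [ContinuousMap.coe_mk, Real.norm_eq_abs, abs_le]
    constructor <;> linarith
  toBall_ret y hy := by
    rw [Real.norm_eq_abs, abs_le] at hy
    simp only [ContinuousMap.coe_mk]
    rw [Set.projIcc_of_mem zero_le_one (x := (y + 1) / 2) ⟨by linarith, by linarith⟩]
    ring

theorem mem_sphere_unitInterval (x : _root_.unitInterval) :
    x ∈ unitInterval.sphere ↔ x = 0 ∨ x = 1 := by
  change |2 * (x : ℝ) - 1| = 1 ↔ _
  rw [abs_eq zero_le_one, or_comm, ← Set.Icc.coe_eq_zero, ← Set.Icc.coe_eq_one]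
  refine or_congr ?_ ?_ <;> constructor <;> intro h <;> linarith

/-- A finite product of balls is a ball for the supremum norm. -/
def pi {D V : Type*} [TopologicalSpace D] [NormedAddCommGroup V] [NormedSpace ℝ V]
    (M : BallModel D V) (ι : Type*) [Fintype ι] : BallModel (ι → D) (ι → V) where
  toBall := ⟨fun x i => M.toBall (x i), by fun_prop⟩
  ret := ⟨fun y i => M.ret (y i), by fun_prop⟩
  ret_toBall x := funext fun i => M.ret_toBall (x i)
  norm_toBall_le x := (pi_norm_le_iff_of_nonneg zero_le_one).2 fun i => M.norm_toBall_le (x i)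
  toBall_ret y hy := funext fun i => M.toBall_ret _ ((norm_le_pi_norm y i).trans hy)

theorem mem_sphere_pi {D V : Type*} [TopologicalSpace D] [NormedAddCommGroup V] [NormedSpace ℝ V]
    (M : BallModel D V) {ι : Type*} [Fintype ι] (x : ι → D) :
    x ∈ (M.pi ι).sphere ↔ ∃ i, x i ∈ M.sphere := by
  have key := (pi_norm_lt_iff (x := (M.pi ι).toBall x) one_pos).not
  rw [not_lt, not_forall] at key
  calc x ∈ (M.pi ι).sphere ↔ 1 ≤ ‖(M.pi ι).toBall x‖ :=
        ⟨fun h => (show ‖_‖ = (1 : ℝ) from h).ge, fun h => le_antisymm ((M.pi ι).norm_toBall_le x) h⟩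
    _ ↔ _ := key
    _ ↔ _ := exists_congr fun i => by
      rw [not_lt]
      exact ⟨fun h => le_antisymm (M.norm_toBall_le _) h, fun h => (show ‖_‖ = (1 : ℝ) from h).ge⟩

/-- A product of two balls is a ball for the supremum norm. -/
def prod {D V D' V' : Type*} [TopologicalSpace D] [NormedAddCommGroup V] [NormedSpace ℝ V]
    [TopologicalSpace D'] [NormedAddCommGroup V'] [NormedSpace ℝ V']
    (M : BallModel D V) (M' : BallModel D' V') : BallModel (D × D') (V × V') where
  toBall := M.toBall.prodMap M'.toBall
  ret := M.ret.prodMap M'.ret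
  ret_toBall _ := Prod.ext (M.ret_toBall _) (M'.ret_toBall _)
  norm_toBall_le _ := max_le (M.norm_toBall_le _) (M'.norm_toBall_le _)
  toBall_ret y hy := Prod.ext (M.toBall_ret _ ((norm_fst_le y).trans hy))
    (M'.toBall_ret _ ((norm_snd_le y).trans hy))

theorem mem_sphere_prod {D V D' V' : Type*} [TopologicalSpace D] [NormedAddCommGroup V]
    [NormedSpace ℝ V] [TopologicalSpace D'] [NormedAddCommGroup V'] [NormedSpace ℝ V']
    (M : BallModel D V) (M' : BallModel D' V') (x : D × D') :
    x ∈ (M.prod M').sphere ↔ x.1 ∈ M.sphere ∨ x.2 ∈ M'.sphere := by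
  have h := M.norm_toBall_le x.1
  have h' := M'.norm_toBall_le x.2
  change max ‖M.toBall x.1‖ ‖M'.toBall x.2‖ = 1 ↔ ‖M.toBall x.1‖ = 1 ∨ ‖M'.toBall x.2‖ = 1
  grind

/-- The cube as a ball. -/
noncomputable abbrev cube (m : ℕ) : BallModel (Fin m → _root_.unitInterval) (Fin m → ℝ) :=
  unitInterval.pi (Fin m)

theorem sphere_cube (m : ℕ) : (cube m).sphere = Cube.boundary (Fin m) := by
  ext x
  rw [mem_sphere_pi]
  exact exists_congr fun i => mem_sphere_unitInterval _

/-- The cylinder over the cube as a ball. -/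
noncomputable abbrev cylinder (m : ℕ) :
    BallModel (_root_.unitInterval × (Fin m → _root_.unitInterval)) (ℝ × (Fin m → ℝ)) :=
  unitInterval.prod (cube m)

theorem mem_sphere_cylinder {m : ℕ} {x : _root_.unitInterval × (Fin m → _root_.unitInterval)} :
    x ∈ (cylinder m).sphere ↔ (x.1 = 0 ∨ x.1 = 1) ∨ x.2 ∈ Cube.boundary (Fin m) := by
  rw [mem_sphere_prod, mem_sphere_unitInterval, sphere_cube]

end BallModel

/-! ### Coreflections -/

namespace TopCategory

theorem continuous_of_space (c : TopCategory) (T : Type u) [TopologicalSpace T] :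
    Continuous fun x : c.Space T => (show T from x) := by
  cases c with
  | general => exact continuous_id
  | compactlyGenerated => exact continuous_from_compactlyGenerated (X := T) _ fun S g => g.continuous
  | deltaGenerated =>
    refine continuous_def.2 fun U hU => ?_
    exact TopologicalSpace.generatedBy_le (X := fun m : ℕ => Fin m → ℝ) U hU

/-- Continuous maps from balls of finite-dimensional normed spaces lift to the coreflections. -/
theorem continuous_to_space (c : TopCategory) {T : Type u} [TopologicalSpace T] {D V : Type}
    [TopologicalSpace D] [NormedAddCommGroup V] [NormedSpace ℝ V] [FiniteDimensional ℝ V]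
    [CompactSpace D] [T2Space D] (M : BallModel D V) {f : D → T} (hf : Continuous f) :
    Continuous fun x => (show c.Space T from f x) := by
  cases c with
  | general => exact hf
  | compactlyGenerated =>
    refine continuous_def.2 fun U hU => ?_
    have hU' := isOpen_sigma_iff.1 (isOpen_coinduced.1 hU)
    -- `ULift` moves `D` into the universe of the test spaces.
    have := hU' ⟨CompHaus.of (ULift.{u} D), ⟨fun x => f x.down, by fun_prop⟩⟩
    exact this.preimage (f := fun x : D => ULift.up.{u} x) (by fun_prop)
  | deltaGenerated =>
    let e : V ≃L[ℝ] (Fin (Module.finrank ℝ V) → ℝ) :=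
      ContinuousLinearEquiv.ofFinrankEq (by simp)
    -- The test spaces are the `ℝᵐ`, so `f` is extended along the retraction `M.ret` to all of `V ≅
    -- ℝᵐ`.
    let g : C(Fin (Module.finrank ℝ V) → ℝ, T) :=
      ⟨fun y => f (M.ret (e.symm y)), by fun_prop⟩
    have hg : Continuous fun y => (show deltaGenerated.Space T from g y) :=
      continuous_iff_coinduced_le.2
        (le_iSup₂_of_le (f := fun (m : ℕ) (h : C(Fin m → ℝ, T)) =>
          TopologicalSpace.coinduced h inferInstance) _ g le_rfl)
    have hh : Continuous fun x => (show deltaGenerated.Space T from g (e (M.toBall x))) :=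
      hg.comp (f := fun x => e (M.toBall x)) (by fun_prop)
    have hfg : f = fun x => g (e (M.toBall x)) := by
      funext x
      simp [g, M.ret_toBall]
    rw [hfg]
    exact hh

end TopCategory

end HoLinks
namespace HoLinks

/-! ### Shrinkable maps -/

/-- The predicate on maps `T → T` of lying over the identity of `B`. -/
def LiesOver {T B : Type*} [TopologicalSpace T] [TopologicalSpace B] (p : C(T, B)) (h : C(T, T)) :
    Prop :=
  ∀ e, p (h e) = p e

section Shrinkable

variable {T B : Type*} [TopologicalSpace T] [TopologicalSpace B] {p : C(T, B)} {r : C(B, T)}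

/-- If `r` is a section of `p` and `r ∘ p` is homotopic to the identity over `B`, then every map
from a ball to `B` with a partial lift over the sphere can be lifted after radial expansion. -/
theorem exists_lift_expand (hr : ∀ b, p (r b) = b)
    (H : (ContinuousMap.id T).HomotopyWith (r.comp p) (LiesOver p))
    {D V : Type*} [TopologicalSpace D] [NormedAddCommGroup V] [NormedSpace ℝ V]
    (M : BallModel D V) (K : C(D, B)) {l : D → T} (hl : ContinuousOn l M.sphere)
    (hlK : ∀ x ∈ M.sphere, p (l x) = K x) :
    ∃ G : C(D, T), (∀ x ∈ M.sphere, G x = l x) ∧ ∀ x, p (G x) = K (M.expand (1, x)) := by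
  classical
  have hH : ∀ t e, p (H (t, e)) = p e := fun t e => H.prop' t e
  let φ : C(D, D) := M.expand.comp ⟨fun x => (1, x), by fun_prop⟩
  have hS : IsClosed {x | φ x ∈ M.sphere} := M.isClosed_sphere.preimage φ.continuous
  have hB : IsClosed {x | ‖M.toBall x‖ ≤ 1 / 2} := isClosed_le (by fun_prop) continuous_const
  -- On the outer shell `G` follows the track of `l (φ x)` under `H`, which ends at `r (K (φ x))`
  -- when the collar function reaches `1`. This is the value used on the inner ball.
  let G : D → T := fun x => if φ x ∈ M.sphere then H (M.collar x, l (φ x)) else r (K (φ x))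
  have hGS : Set.EqOn G (fun x => H (M.collar x, l (φ x))) {x | φ x ∈ M.sphere} :=
    fun x hx => if_pos hx
  have hGB : Set.EqOn G (fun x => r (K (φ x))) {x | ‖M.toBall x‖ ≤ 1 / 2} := by
    intro x hx
    by_cases h : φ x ∈ M.sphere
    · have h1 : H (M.collar x, l (φ x)) = r (p (l (φ x))) := by
        rw [M.collar_eq_one hx]
        exact H.apply_one _
      exact (hGS h).trans (h1.trans (by rw [hlK _ h]))
    · exact if_neg h
  have hG : Continuous G := by
    rw [← continuousOn_univ]
    have hU : Set.univ = {x | φ x ∈ M.sphere} ∪ {x | ‖M.toBall x‖ ≤ 1 / 2} := by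
      refine (Set.eq_univ_of_forall fun x => ?_).symm
      rcases le_total ‖M.toBall x‖ (1 / 2) with h | h
      · exact Or.inr h
      · exact Or.inl (M.expand_one_mem_sphere h)
    rw [hU]
    refine ContinuousOn.union_of_isClosed (ContinuousOn.congr ?_ hGS) (ContinuousOn.congr ?_ hGB)
      hS hB
    · exact H.continuous.comp_continuousOn (M.collar.continuous.continuousOn.prodMk
        (hl.comp φ.continuous.continuousOn fun x hx => hx))
    · exact (Continuous.continuousOn (by fun_prop))
  refine ⟨⟨G, hG⟩, fun x hx => ?_, fun x => ?_⟩
  · have hφ : φ x = x := M.expand_of_mem_sphere 1 hx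
    have hx' : φ x ∈ M.sphere := by rwa [hφ]
    change G x = l x
    refine (hGS hx').trans ?_
    simp only [M.collar_of_mem_sphere hx, hφ]
    exact H.apply_zero _
  · change p (G x) = K (φ x)
    by_cases h : φ x ∈ M.sphere
    · rw [hGS h, hH, hlK _ h]
    · rw [show G x = _ from if_neg h, hr]

end Shrinkable

/-! ### Weak equivalences of coreflections from fibrewise homotopies -/

section WeakEquivalence

variable (c : TopCategory) {T B : Type u} [TopologicalSpace T] [TopologicalSpace B] {p : C(T, B)}
  {r : C(B, T)}

theorem bijective_piZeroMap_of_section (hr : ∀ b, p (r b) = b)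
    (H : (ContinuousMap.id T).HomotopyWith (r.comp p) (LiesOver p)) :
    Function.Bijective (piZeroMap (c.map p)) := by
  have hj : ∀ e : c.Space T, Joined e (c.map r (c.map p e)) := fun e => by
    have h : Continuous fun t : unitInterval => (show c.Space T from H (t, e)) :=
      c.continuous_to_space BallModel.unitInterval (f := fun t => H (t, e)) (by fun_prop)
    exact ⟨⟨⟨_, h⟩, H.apply_zero e, H.apply_one e⟩⟩
  constructor
  · rintro ⟨x⟩ ⟨y⟩ hxy
    have hxy' : Joined (c.map p x) (c.map p y) := Quotient.exact hxy
    exact Quotient.sound (((hj x).trans (hxy'.map (c.map r).continuous)).trans (hj y).symm)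
  · rintro ⟨b⟩
    exact ⟨Quotient.mk _ (c.map r b), congrArg (Quotient.mk _) (hr b)⟩

/-- A homotopy between the images is a map on the cylinder, itself a ball. The two loops on the
ends, and the base point on the sides, lift it over the sphere. Only the boundary values of the
resulting `G` matter, so the expansion does no harm. -/
theorem injective_piMap_of_section (hr : ∀ b, p (r b) = b)
    (H : (ContinuousMap.id T).HomotopyWith (r.comp p) (LiesOver p)) (m : ℕ) (e : c.Space T) :
    Function.Injective (piMap m (c.map p) e) := by
  classical
  rintro ⟨γ₀⟩ ⟨γ₁⟩ h
  obtain ⟨K⟩ : ((c.map p).comp γ₀.1).HomotopicRel ((c.map p).comp γ₁.1)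
    (Cube.boundary (Fin m)) := Quotient.exact h
  let g₀ : C(Fin m → unitInterval, T) :=
    ⟨fun y => γ₀.1 y, (c.continuous_of_space T).comp γ₀.1.continuous⟩
  let g₁ : C(Fin m → unitInterval, T) :=
    ⟨fun y => γ₁.1 y, (c.continuous_of_space T).comp γ₁.1.continuous⟩
  let K' : C(unitInterval × (Fin m → unitInterval), B) :=
    ⟨fun x => K x, (c.continuous_of_space B).comp K.continuous⟩
  have hK₀ : ∀ y, K' (0, y) = p (g₀ y) := fun y => K.apply_zero y
  have hK₁ : ∀ y, K' (1, y) = p (g₁ y) := fun y => K.apply_one y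
  have hKb : ∀ t, ∀ y ∈ Cube.boundary (Fin m), K' (t, y) = p (g₀ y) :=
    fun t y hy => K.eq_fst t hy
  -- The cut at `1 / 2` is arbitrary: on the sphere, points with `0 < t < 1` lie on the sides, where
  -- `g₀` and `g₁` agree.
  let l : unitInterval × (Fin m → unitInterval) → T :=
    fun x => if (x.1 : ℝ) ≤ 1 / 2 then g₀ x.2 else g₁ x.2
  have hγ : ∀ y ∈ Cube.boundary (Fin m), g₀ y = g₁ y :=
    fun y hy => (γ₀.2 y hy).trans (γ₁.2 y hy).symm
  have hlb : ∀ t, ∀ y ∈ Cube.boundary (Fin m), l (t, y) = g₀ y := fun t y hy => by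
    simp only [l]
    split_ifs
    exacts [rfl, (hγ y hy).symm]
  have hl₀ : ∀ y, l (0, y) = g₀ y := fun y => if_pos (by norm_num)
  have hl₁ : ∀ y, l (1, y) = g₁ y := fun y => if_neg (by norm_num)
  have hl : ContinuousOn l (BallModel.cylinder m).sphere := by
    have hsplit : (BallModel.cylinder m).sphere =
        (BallModel.cylinder m).sphere ∩ {x | (x.1 : ℝ) ≤ 1 / 2} ∪
          (BallModel.cylinder m).sphere ∩ {x | 1 / 2 ≤ (x.1 : ℝ)} := by
      rw [← Set.inter_union_distrib_left, Set.inter_eq_left.2]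
      exact fun x _ => le_total (x.1 : ℝ) (1 / 2)
    rw [hsplit]
    refine ContinuousOn.union_of_isClosed (ContinuousOn.congr (f := fun x : unitInterval × (Fin m → unitInterval) => g₀ x.2) ?_ ?_)
      (ContinuousOn.congr (f := fun x : unitInterval × (Fin m → unitInterval) => g₁ x.2) ?_ ?_) ?_ ?_
    · exact (show Continuous _ by fun_prop).continuousOn
    · exact fun x hx => if_pos hx.2
    · exact (show Continuous _ by fun_prop).continuousOn
    · rintro ⟨t, y⟩ ⟨hx, ht⟩
      rcases BallModel.mem_sphere_cylinder.1 hx with (h | h) | h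
      · simp only at h
        subst h
        norm_num at ht
      · simp only at h
        subst h
        exact hl₁ y
      · exact (hlb t y h).trans (hγ y h)
    · exact (BallModel.isClosed_sphere _).inter (isClosed_le (by fun_prop) continuous_const)
    · exact (BallModel.isClosed_sphere _).inter (isClosed_le continuous_const (by fun_prop))
  obtain ⟨G, hG, -⟩ := exists_lift_expand hr H (BallModel.cylinder m) K' hl (by
    rintro ⟨t, y⟩ hx
    rcases BallModel.mem_sphere_cylinder.1 hx with (h | h) | h
    · simp only at h
      subst h
      rw [hl₀, hK₀]
    · simp only at h
      subst h
      rw [hl₁, hK₁]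
    · rw [hlb t y h, hKb t y h])
  refine Quotient.sound ⟨⟨⟨⟨fun x => G x,
    c.continuous_to_space (BallModel.cylinder m) G.continuous⟩, fun y => ?_, fun y => ?_⟩,
    fun t y hy => ?_⟩⟩
  · exact (hG _ (BallModel.mem_sphere_cylinder.2 (Or.inl (Or.inl rfl)))).trans (hl₀ y)
  · exact (hG _ (BallModel.mem_sphere_cylinder.2 (Or.inl (Or.inr rfl)))).trans (hl₁ y)
  · exact (hG _ (BallModel.mem_sphere_cylinder.2 (Or.inr hy))).trans (hlb t y hy)

/-- Lifting with constant boundary value `e` yields a loop over the expanded `γ`, and `expand`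
itself is a homotopy rel boundary from `γ` to that loop. -/
theorem surjective_piMap_of_section (hr : ∀ b, p (r b) = b)
    (H : (ContinuousMap.id T).HomotopyWith (r.comp p) (LiesOver p)) (m : ℕ) (e : c.Space T) :
    Function.Surjective (piMap m (c.map p) e) := by
  rintro ⟨γ⟩
  let K : C(Fin m → unitInterval, B) :=
    ⟨fun x => γ.1 x, (c.continuous_of_space B).comp γ.1.continuous⟩
  obtain ⟨G, hG, hpG⟩ := exists_lift_expand hr H (BallModel.cube m) K
    (l := fun _ => e) continuousOn_const (by
      intro x hx
      rw [BallModel.sphere_cube] at hx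
      exact (γ.2 x hx).symm)
  rw [BallModel.sphere_cube] at hG
  refine ⟨Quotient.mk _ ⟨⟨fun x => G x, c.continuous_to_space (BallModel.cube m) G.continuous⟩,
    hG⟩, Quotient.sound (Nonempty.intro (ContinuousMap.HomotopyRel.symm ⟨⟨γ.1.comp
      (BallModel.cube m).expand, fun y => ?_, fun y => ?_⟩, fun t y hy => ?_⟩))⟩
  · exact congrArg γ.1 ((BallModel.cube m).expand_zero y)
  · exact (hpG y).symm
  · rw [← BallModel.sphere_cube] at hy
    exact congrArg γ.1 ((BallModel.cube m).expand_of_mem_sphere t hy)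

/-- A map with a section which is a fibrewise homotopy inverse induces weak homotopy equivalences
of coreflections. -/
theorem isWeakHomotopyEquiv_of_section (hr : ∀ b, p (r b) = b)
    (H : (ContinuousMap.id T).HomotopicWith (r.comp p) (LiesOver p)) :
    IsWeakHomotopyEquiv (c.map p) := by
  obtain ⟨H⟩ := H
  exact ⟨bijective_piZeroMap_of_section c hr H, fun m e =>
    ⟨injective_piMap_of_section c hr H _ e, surjective_piMap_of_section c hr H _ e⟩⟩

end WeakEquivalence

end HoLinks
namespace HoLinks

/-! ### Simplicial maps and segments in the simplex -/

namespace Simplex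

variable {n : ℕ}

theorem pos_topIndex (w : Simplex n) : 0 < w.1 w.topIndex :=
  (Finset.mem_filter.1 (Finset.max'_mem _ w.support_nonempty)).2

theorem le_topIndex {w : Simplex n} {i : Fin (n + 1)} (hi : 0 < w.1 i) : i ≤ w.topIndex :=
  Finset.le_max' _ i (by simpa using hi)

theorem topIndex_eq {w : Simplex n} {j : Fin (n + 1)} (hj : 0 < w.1 j)
    (h : ∀ i, 0 < w.1 i → i ≤ j) : w.topIndex = j :=
  le_antisymm (h _ w.pos_topIndex) (le_topIndex hj)

theorem nonneg (w : Simplex n) (i : Fin (n + 1)) : 0 ≤ w.1 i := w.2.1 i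

theorem map_pos_iff (f : Fin (n + 1) → Fin (n + 1)) (w : Simplex n) (j : Fin (n + 1)) :
    0 < (stdSimplex.map f w).1 j ↔ ∃ i, f i = j ∧ 0 < w.1 i := by
  have h : (stdSimplex.map f w).1 j = ∑ i with f i = j, w.1 i :=
    FunOnFinite.linearMap_apply_apply ℝ ℝ f w.1 j
  rw [h, Finset.sum_pos_iff_of_nonneg fun i _ => w.nonneg i]
  simp

theorem topIndex_map {f : Fin (n + 1) → Fin (n + 1)} (hf : Monotone f) (w : Simplex n) :
    topIndex (stdSimplex.map f w) = f w.topIndex := by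
  refine topIndex_eq ((map_pos_iff _ _ _).2 ⟨_, rfl, w.pos_topIndex⟩) fun j hj => ?_
  obtain ⟨i, rfl, hi⟩ := (map_pos_iff _ _ _).1 hj
  exact hf (le_topIndex hi)

theorem eq_topVertex {w : Simplex n} (h : ∀ i, 0 < w.1 i → i = Fin.last n) :
    w = topVertex n := by
  have h0 : ∀ i, i ≠ Fin.last n → w.1 i = 0 := fun i hi =>
    le_antisymm (not_lt.1 fun hw => hi (h i hw)) (w.nonneg i)
  have h1 : w.1 (Fin.last n) = 1 := by
    rw [← w.2.2]
    exact (Fintype.sum_eq_single _ h0).symm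
  refine Subtype.ext (funext fun i => ?_)
  by_cases hi : i = Fin.last n
  · subst hi
    simp [h1, topVertex]
  · rw [h0 i hi]
    simp [topVertex, hi]

theorem topVertex_pos {i : Fin (n + 1)} (h : 0 < (topVertex n).1 i) : i = Fin.last n :=
  le_antisymm (Fin.le_last i) (by
    by_contra hi
    have : i ≠ Fin.last n := fun hi' => hi hi'.ge
    simp [topVertex, this] at h)

theorem map_topVertex {f : Fin (n + 1) → Fin (n + 1)} (hf : f (Fin.last n) = Fin.last n) :
    stdSimplex.map f (topVertex n) = topVertex n := by
  refine eq_topVertex fun j hj => ?_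
  obtain ⟨i, rfl, hi⟩ := (map_pos_iff _ _ _).1 hj
  rw [topVertex_pos hi, hf]

theorem map_const_last (w : Simplex n) :
    stdSimplex.map (fun _ => Fin.last n) w = topVertex n := by
  refine eq_topVertex fun j hj => ?_
  obtain ⟨i, h, -⟩ := (map_pos_iff _ _ _).1 hj
  exact h.symm

/-- The point `(1 - t) x + t y` of the segment from `x` to `y`. -/
def segment (t : unitInterval) (x y : Simplex n) : Simplex n :=
  ⟨(1 - (t : ℝ)) • x.1 + (t : ℝ) • y.1,
    convex_stdSimplex ℝ _ x.2 y.2 (sub_nonneg.2 t.2.2) t.2.1 (by ring)⟩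

theorem segment_apply (t : unitInterval) (x y : Simplex n) (i : Fin (n + 1)) :
    (segment t x y).1 i = (1 - (t : ℝ)) * x.1 i + t * y.1 i := rfl

@[fun_prop]
theorem continuous_segment {Z : Type*} [TopologicalSpace Z] {t : Z → unitInterval}
    {x y : Z → Simplex n} (ht : Continuous t) (hx : Continuous x) (hy : Continuous y) :
    Continuous fun z => segment (t z) (x z) (y z) :=
  Continuous.subtype_mk (by fun_prop) _

@[simp]
theorem segment_zero (x y : Simplex n) : segment 0 x y = x :=
  Subtype.ext (funext fun i => by simp [segment_apply])

@[simp]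
theorem segment_one (x y : Simplex n) : segment 1 x y = y :=
  Subtype.ext (funext fun i => by simp [segment_apply])

@[simp]
theorem segment_self (t : unitInterval) (x : Simplex n) : segment t x x = x :=
  Subtype.ext (funext fun i => by rw [segment_apply]; ring)

theorem segment_pos {t : unitInterval} {x y : Simplex n} {i : Fin (n + 1)} (hx : 0 < x.1 i)
    (hy : 0 < y.1 i) : 0 < (segment t x y).1 i := by
  rw [segment_apply]
  have h0 := t.2.1
  have h1 := t.2.2
  nlinarith [mul_nonneg (sub_nonneg.2 h1) hx.le, mul_nonneg h0 hy.le]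

theorem pos_or_pos_of_segment_pos {t : unitInterval} {x y : Simplex n} {i : Fin (n + 1)}
    (h : 0 < (segment t x y).1 i) : 0 < x.1 i ∨ 0 < y.1 i := by
  by_contra! hxy
  rw [segment_apply, le_antisymm hxy.1 (x.nonneg i), le_antisymm hxy.2 (y.nonneg i)] at h
  simp at h

theorem topIndex_segment {t : unitInterval} {x y : Simplex n} {j : Fin (n + 1)}
    (hx : x.topIndex = j) (hy : y.topIndex = j) : (segment t x y).topIndex = j := by
  refine topIndex_eq (segment_pos (hx ▸ x.pos_topIndex) (hy ▸ y.pos_topIndex)) fun i hi => ?_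
  rcases pos_or_pos_of_segment_pos hi with h | h
  · exact hx ▸ le_topIndex h
  · exact hy ▸ le_topIndex h

theorem topIndex_segment_of_right {t : unitInterval} {x y : Simplex n} (ht : t ≠ 0)
    (hy : y.topIndex = Fin.last n) : (segment t x y).topIndex = Fin.last n := by
  refine topIndex_eq ?_ fun i _ => Fin.le_last i
  have h := y.pos_topIndex
  rw [hy] at h
  rw [segment_apply]
  have h0 : 0 < (t : ℝ) := unitInterval.pos_iff_ne_zero.2 ht
  have := mul_nonneg (sub_nonneg.2 t.2.2) (x.nonneg (Fin.last n))
  have := mul_pos h0 h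
  linarith

/-- The map of vertices that fixes those of index less than `k` and sends the others to the top
vertex. -/
def collapse (k i : Fin (n + 1)) : Fin (n + 1) := if i < k then i else Fin.last n

theorem monotone_collapse (k : Fin (n + 1)) : Monotone (collapse k) := by
  intro i j hij
  unfold collapse
  split_ifs with h h' h'
  exacts [hij, Fin.le_last i, (h (hij.trans_lt h')).elim, le_rfl]

theorem monotone_max_right (k : Fin (n + 1)) : Monotone fun i : Fin (n + 1) => max i k :=
  fun _ _ h => max_le_max_right k h

/-- This and the next three lemmas give the ends of the chain of homotopies: the identity paired
with the constant map at `vₙ` for `k = n`, and the reverse for `k = 0`. -/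
theorem map_collapse_last (w : Simplex n) : stdSimplex.map (collapse (Fin.last n)) w = w := by
  have h : collapse (Fin.last n) = id := by
    funext i
    unfold collapse
    split_ifs with h
    exacts [rfl, (Fin.last_le_iff.1 (not_lt.1 h)).symm]
  rw [h, stdSimplex.map_id_apply]

theorem map_collapse_zero (w : Simplex n) : stdSimplex.map (collapse 0) w = topVertex n :=
  map_const_last w

theorem map_max_last (w : Simplex n) :
    stdSimplex.map (fun i => max i (Fin.last n)) w = topVertex n := by
  simpa only [max_eq_right (Fin.le_last _)] using map_const_last w

theorem map_max_zero (w : Simplex n) : stdSimplex.map (fun i => max i 0) w = w := by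
  simp only [max_eq_left (Fin.zero_le _)]
  exact stdSimplex.map_id_apply w

theorem map_max_apply_eq_zero {k l i : Fin (n + 1)} (hkl : k ≤ l) (hi : i < k) (w : Simplex n) :
    (stdSimplex.map (fun i => max i l) w).1 i = 0 := by
  refine le_antisymm (not_lt.1 fun h => ?_) (nonneg _ i)
  obtain ⟨j, rfl, -⟩ := (map_pos_iff _ _ _).1 h
  exact absurd (le_max_right j l) (not_le.2 (hi.trans_le hkl))

end Simplex

/-! ### The plain homotopy link -/

variable {P : Type v} [PartialOrder P] {X : Type u} [TopologicalSpace X]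

/-- The stratum `X_p` with the relative topology. -/
abbrev PlainStratum (s : C(X, WithUpperSet P)) (p : P) : Type u :=
  {x : X // s x = WithUpperSet.toUpperSet p}

/-- The homotopy link with the compact-open topology. -/
abbrev PlainHoLink (s : C(X, WithUpperSet P)) {n : ℕ} (I : Fin (n + 1) ↪o P) : Type u :=
  {σ : C(Simplex n, X) // ∀ w, s (σ w) = simplexStrat I w}

/-- Evaluation at the top vertex, for the compact-open topology. -/
def PlainHoLink.ev (s : C(X, WithUpperSet P)) {n : ℕ} (I : Fin (n + 1) ↪o P) :
    C(PlainHoLink s I, PlainStratum s (I (Fin.last n))) :=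
  ⟨fun σ => ⟨σ.1 (Simplex.topVertex n), strat_topVertex s I σ⟩, continuous_evalTopVertex s I⟩

/-- Almost stratum-preserving retractions for the plain product topology. -/
structure IsPlainAspire (s : C(X, WithUpperSet P)) {n : ℕ} (I : Fin (n + 1) ↪o P)
    (R : C(PlainStratum s (I (Fin.last n)) × Simplex n, X)) : Prop where
  stratum_preserving : ∀ (x : PlainStratum s (I (Fin.last n))) (w : Simplex n),
    s (R (x, w)) = simplexStrat I w
  extends_continuously : ∀ k : Fin (n + 1),
    ∃ F : C(TopOrBelow s I k × UpperFace n k, X),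
      (∀ (x : TopOrBelow s I k) (w : UpperFace n k)
        (hx : s x.1 = WithUpperSet.toUpperSet (I (Fin.last n))), F (x, w) = R (⟨x.1, hx⟩, w.1)) ∧
      (∀ (x : TopOrBelow s I k) (w : UpperFace n k),
        s x.1 ≤ WithUpperSet.toUpperSet (I k) → F (x, w) = x.1)

variable {s : C(X, WithUpperSet P)} {n : ℕ} {I : Fin (n + 1) ↪o P}

/-- The continuous extension over the whole simplex shows that an aspire is continuous for the
plain product topology. -/
theorem AdmitsAspire.exists_isPlainAspire {c : TopCategory} (h : AdmitsAspire c s I) :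
    ∃ R, IsPlainAspire s I R := by
  obtain ⟨R, hR⟩ := h
  -- For `k = 0` the upper face is the whole simplex.
  obtain ⟨F, hF, -⟩ := hR.extends_continuously 0
  let R' : C(PlainStratum s (I (Fin.last n)) × Simplex n, X) :=
    ⟨fun x => F (⟨x.1.1, Or.inl x.1.2⟩, ⟨x.2, fun i hi => (Fin.not_lt_zero i hi).elim⟩),
      by fun_prop⟩
  have hR' : ∀ (x : PlainStratum s (I (Fin.last n))) (w : Simplex n),
      R' (x, w) = R ((x : Stratum c s (I (Fin.last n))), w) := fun x w => hF _ _ x.2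
  refine ⟨R', fun x w => ?_, fun k => ?_⟩
  · rw [hR']
    exact hR.stratum_preserving x w
  · obtain ⟨G, hG, hG'⟩ := hR.extends_continuously k
    exact ⟨G, fun x w hx => (hG x w hx).trans (hR' _ _).symm, hG'⟩

/-! ### The fibrewise homotopy built from an aspire -/

namespace IsPlainAspire

variable {R : C(PlainStratum s (I (Fin.last n)) × Simplex n, X)}

open scoped Classical in
/-- The map `(x, u) ↦ R(x, u)` for `x` in the top stratum, extended by `(x, u) ↦ x`. -/
noncomputable def extend (R : C(PlainStratum s (I (Fin.last n)) × Simplex n, X)) (x : X)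
    (u : Simplex n) : X :=
  if hx : s x = WithUpperSet.toUpperSet (I (Fin.last n)) then R (⟨x, hx⟩, u) else x

theorem extend_of_mem {x : X} (hx : s x = WithUpperSet.toUpperSet (I (Fin.last n)))
    (u : Simplex n) : extend R x u = R (⟨x, hx⟩, u) :=
  dif_pos hx

/-- A single formula `extend R`, independent of `k`, describes all the extensions, so homotopies
built at different `k` can be concatenated. -/
theorem exists_eq_extend (hR : IsPlainAspire s I R) (k : Fin (n + 1)) :
    ∃ F : C(TopOrBelow s I k × UpperFace n k, X), (∀ x w, F (x, w) = extend R x.1 w.1) ∧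
      ∀ (x : TopOrBelow s I k) (w : UpperFace n k),
        s x.1 ≤ WithUpperSet.toUpperSet (I k) → F (x, w) = x.1 := by
  obtain ⟨F, hF, hF'⟩ := hR.extends_continuously k
  refine ⟨F, fun x w => ?_, hF'⟩
  by_cases hx : s x.1 = WithUpperSet.toUpperSet (I (Fin.last n))
  · rw [extend_of_mem hx, hF]
  · rw [hF' x w (x.2.resolve_left hx)]
    simp only [extend, dif_neg hx]

theorem apply_topVertex (hR : IsPlainAspire s I R) (x : PlainStratum s (I (Fin.last n))) :
    R (x, Simplex.topVertex n) = x.1 := by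
  -- For `k = n` both clauses apply to `x` in the top stratum, and `vₙ` lies in the upper face.
  obtain ⟨F, hF, hF'⟩ := hR.extends_continuously (Fin.last n)
  have hw : ∀ i, i < Fin.last n → (Simplex.topVertex n).1 i = 0 := fun i hi => by
    simp [Simplex.topVertex, hi.ne]
  exact (hF ⟨x.1, Or.inl x.2⟩ ⟨_, hw⟩ x.2).symm.trans (hF' _ _ x.2.le)

theorem extend_topVertex (hR : IsPlainAspire s I R) (x : X) :
    extend R x (Simplex.topVertex n) = x := by
  unfold extend
  split_ifs with hx
  exacts [hR.apply_topVertex ⟨x, hx⟩, rfl]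

/-- The section of the evaluation map given by an aspire. -/
def toSection (hR : IsPlainAspire s I R) :
    C(PlainStratum s (I (Fin.last n)), PlainHoLink s I) :=
  ⟨fun x => ⟨R.curry x, hR.stratum_preserving x⟩, R.curry.continuous.subtype_mk _⟩

theorem ev_toSection (hR : IsPlainAspire s I R) (x : PlainStratum s (I (Fin.last n))) :
    PlainHoLink.ev s I (hR.toSection x) = x :=
  Subtype.ext (hR.apply_topVertex x)

/-- The condition on `a, u` which guarantees that `extend R (σ a) u` lies in the stratum of `w`,
for every `σ` in the homotopy link. -/
def Compatible (k : Fin (n + 1)) (a u w : Simplex n) : Prop :=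
  (∀ i, i < k → u.1 i = 0) ∧ ((a.topIndex = Fin.last n ∧ u.topIndex = w.topIndex) ∨
    (a.topIndex = w.topIndex ∧ a.topIndex ≤ k))

/-- Families of self-maps of the simplex give homotopies of self-maps of the homotopy link. -/
theorem exists_homotopicWith (hR : IsPlainAspire s I R) (k : Fin (n + 1))
    (a u : C(unitInterval × Simplex n, Simplex n))
    (h : ∀ t w, Compatible k (a (t, w)) (u (t, w)) w)
    (ha : ∀ t, a (t, Simplex.topVertex n) = Simplex.topVertex n)
    (hu : ∀ t, u (t, Simplex.topVertex n) = Simplex.topVertex n) :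
    ∃ f g : C(PlainHoLink s I, PlainHoLink s I),
      (∀ σ w, (f σ).1 w = extend R (σ.1 (a (0, w))) (u (0, w))) ∧
      (∀ σ w, (g σ).1 w = extend R (σ.1 (a (1, w))) (u (1, w))) ∧
      f.HomotopicWith g (LiesOver (PlainHoLink.ev s I)) := by
  obtain ⟨F, hF, hF'⟩ := hR.exists_eq_extend k
  have htop : ∀ (σ : PlainHoLink s I) (x : Simplex n), x.topIndex = Fin.last n →
      s (σ.1 x) = WithUpperSet.toUpperSet (I (Fin.last n)) := fun σ x hx => by
    rw [σ.2, ← hx]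
    rfl
  have hlow : ∀ (σ : PlainHoLink s I) (x : Simplex n), x.topIndex ≤ k →
      s (σ.1 x) ≤ WithUpperSet.toUpperSet (I k) := fun σ x hx => by
    rw [σ.2]
    exact I.monotone hx
  have hmem : ∀ (σ : PlainHoLink s I) t w,
      s (σ.1 (a (t, w))) = WithUpperSet.toUpperSet (I (Fin.last n)) ∨
        s (σ.1 (a (t, w))) ≤ WithUpperSet.toUpperSet (I k) := fun σ t w =>
    (h t w).2.imp (fun h => htop σ _ h.1) (fun h => hlow σ _ h.2)
  -- Evaluation is jointly continuous because the simplex is locally compact; currying then gives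
  -- the map into the link.
  let J : C((unitInterval × PlainHoLink s I) × Simplex n, X) :=
    ⟨fun z => F (⟨z.1.2.1 (a (z.1.1, z.2)), hmem _ _ _⟩, ⟨u (z.1.1, z.2), (h _ _).1⟩), by
      refine F.continuous.comp (Continuous.prodMk (Continuous.subtype_mk ?_ _)
        (Continuous.subtype_mk ?_ _)) <;> fun_prop⟩
  have hJ : ∀ t σ w, J ((t, σ), w) = extend R (σ.1 (a (t, w))) (u (t, w)) :=
    fun t σ w => hF _ _
  have hJs : ∀ z w, s (J.curry z w) = simplexStrat I w := by
    rintro ⟨t, σ⟩ w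
    rcases (h t w).2 with h' | h'
    · change s (J ((t, σ), w)) = _
      rw [hJ, extend_of_mem (htop σ _ h'.1), hR.stratum_preserving]
      exact congrArg (fun i => WithUpperSet.toUpperSet (I i)) h'.2
    · refine (congrArg s (hF' _ _ (hlow σ _ h'.2))).trans ((σ.2 _).trans ?_)
      exact congrArg (fun i => WithUpperSet.toUpperSet (I i)) h'.1
  let Φ : C(unitInterval × PlainHoLink s I, PlainHoLink s I) :=
    ⟨fun z => ⟨J.curry z, hJs z⟩, J.curry.continuous.subtype_mk _⟩
  refine ⟨Φ.comp ⟨fun σ => (0, σ), by fun_prop⟩, Φ.comp ⟨fun σ => (1, σ), by fun_prop⟩,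
    fun σ w => hJ _ _ _, fun σ w => hJ _ _ _,
    ⟨⟨⟨Φ, fun σ => rfl, fun σ => rfl⟩, fun t σ => Subtype.ext ?_⟩⟩⟩
  change J ((t, σ), Simplex.topVertex n) = σ.1 (Simplex.topVertex n)
  rw [hJ, ha, hu, hR.extend_topVertex]

-- The point `a` stays fixed and only `u` moves. If `w` has top index at most `k`, then `a` shares
-- its stratum and `u` is irrelevant; otherwise `a` is in the top stratum and both ends of the
-- segment share the top index of `w`.
open Simplex in
theorem compatible_map_collapse_succ (k : Fin n) (t : unitInterval) (w : Simplex n) :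
    Compatible k.castSucc (stdSimplex.map (collapse k.succ) w)
      (segment t (stdSimplex.map (fun i => max i k.succ) w)
        (stdSimplex.map (fun i => max i k.castSucc) w)) w := by
  refine ⟨fun i hi => ?_, ?_⟩
  · rw [segment_apply, map_max_apply_eq_zero k.castSucc_lt_succ.le hi,
      map_max_apply_eq_zero le_rfl hi]
    ring
  · rw [topIndex_map (monotone_collapse _)]
    rcases lt_or_ge w.topIndex k.succ with h | h
    · rw [collapse, if_pos h]
      exact Or.inr ⟨rfl, Fin.le_castSucc_iff.2 h⟩
    · rw [collapse, if_neg h.not_gt]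
      refine Or.inl ⟨rfl, topIndex_segment ?_ ?_⟩
      · rw [topIndex_map (monotone_max_right _), max_eq_left h]
      · rw [topIndex_map (monotone_max_right _), max_eq_left (k.castSucc_lt_succ.le.trans h)]

open Simplex in
theorem compatible_map_max_castSucc (k : Fin n) (t : unitInterval) (w : Simplex n) :
    Compatible k.castSucc (segment t (stdSimplex.map (collapse k.succ) w)
        (stdSimplex.map (collapse k.castSucc) w))
      (stdSimplex.map (fun i => max i k.castSucc) w) w := by
  refine ⟨fun i hi => map_max_apply_eq_zero le_rfl hi w, ?_⟩
  rw [topIndex_map (f := fun i => max i k.castSucc) (monotone_max_right _)]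
  have hx := topIndex_map (monotone_collapse k.succ) w
  have hy := topIndex_map (monotone_collapse k.castSucc) w
  unfold collapse at hx hy
  rcases lt_or_ge w.topIndex k.castSucc with h | h
  · rw [if_pos (h.trans k.castSucc_lt_succ)] at hx
    rw [if_pos h] at hy
    have := topIndex_segment (t := t) hx hy
    exact Or.inr ⟨this, this.le.trans h.le⟩
  · rw [if_neg h.not_gt] at hy
    -- If `w` has top index exactly `k`, then `a` jumps from stratum `k` to the top stratum as soon
    -- as `t > 0`. Here the continuity of the aspire extension across `X_{pₙ} ∪ X_{≤ p_k}` is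
    -- essential.
    rcases eq_or_ne t 0 with rfl | ht
    · rw [segment_zero]
      rcases lt_or_ge w.topIndex k.succ with h' | h'
      · rw [if_pos h'] at hx
        exact Or.inr ⟨hx, hx.le.trans (Fin.le_castSucc_iff.2 h')⟩
      · rw [if_neg h'.not_gt] at hx
        exact Or.inl ⟨hx, max_eq_left h⟩
    · exact Or.inl ⟨topIndex_segment_of_right ht hy, max_eq_left h⟩

-- Descending induction on `k`: each step appends the two moves, of `u` and then of `a`.
open Simplex in
theorem homotopicWith_collapse (hR : IsPlainAspire s I R) (k : Fin (n + 1)) :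
    ∃ f : C(PlainHoLink s I, PlainHoLink s I),
      (∀ σ w, (f σ).1 w = extend R (σ.1 (stdSimplex.map (collapse k) w))
        (stdSimplex.map (fun i => max i k) w)) ∧
      (ContinuousMap.id _).HomotopicWith f (LiesOver (PlainHoLink.ev s I)) := by
  have hα : ∀ k : Fin (n + 1), stdSimplex.map (collapse k) (topVertex n) = topVertex n :=
    fun k => map_topVertex (if_neg (Fin.le_last k).not_gt)
  have hβ : ∀ k : Fin (n + 1), stdSimplex.map (fun i => max i k) (topVertex n) = topVertex n :=
    fun k => map_topVertex (max_eq_left (Fin.le_last k))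
  have hc : ∀ f : Fin (n + 1) → Fin (n + 1),
      Continuous fun z : unitInterval × Simplex n => stdSimplex.map f z.2 :=
    fun f => (stdSimplex.continuous_map f).comp continuous_snd
  induction k using Fin.reverseInduction with
  | last =>
    refine ⟨ContinuousMap.id _, fun σ w => ?_, .refl _ fun _ => rfl⟩
    rw [map_collapse_last, map_max_last, hR.extend_topVertex]
    rfl
  | cast k ih =>
    obtain ⟨f, hf, hf'⟩ := ih
    obtain ⟨f₀, f₁, h₀, h₁, h₀₁⟩ := hR.exists_homotopicWith k.castSucc
      ⟨fun z => stdSimplex.map (collapse k.succ) z.2, hc _⟩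
      ⟨fun z => segment z.1 (stdSimplex.map (fun i => max i k.succ) z.2)
        (stdSimplex.map (fun i => max i k.castSucc) z.2),
        continuous_segment continuous_fst (hc _) (hc _)⟩
      (compatible_map_collapse_succ k) (fun t => hα _) (fun t => by simp [hβ])
    obtain ⟨g₀, g₁, h₀', h₁', h₀₁'⟩ := hR.exists_homotopicWith k.castSucc
      ⟨fun z => segment z.1 (stdSimplex.map (collapse k.succ) z.2)
        (stdSimplex.map (collapse k.castSucc) z.2),
        continuous_segment continuous_fst (hc _) (hc _)⟩
      ⟨fun z => stdSimplex.map (fun i => max i k.castSucc) z.2, hc _⟩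
      (compatible_map_max_castSucc k) (fun t => by simp [hα]) (fun t => hβ _)
    have e₀ : f = f₀ := by
      ext σ w
      rw [hf, h₀]
      simp
    have e₁ : f₁ = g₀ := by
      ext σ w
      rw [h₁, h₀']
      simp
    subst e₀ e₁
    refine ⟨g₁, fun σ w => ?_, (hf'.trans h₀₁).trans h₀₁'⟩
    rw [h₁']
    simp

theorem homotopicWith_section_comp_ev (hR : IsPlainAspire s I R) :
    (ContinuousMap.id _).HomotopicWith (hR.toSection.comp (PlainHoLink.ev s I))
      (LiesOver (PlainHoLink.ev s I)) := by
  obtain ⟨f, hf, hf'⟩ := hR.homotopicWith_collapse 0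
  have e : f = hR.toSection.comp (PlainHoLink.ev s I) := by
    ext σ w
    rw [hf, Simplex.map_collapse_zero, Simplex.map_max_zero, extend_of_mem (strat_topVertex s I σ)]
    rfl
  rwa [e] at hf'

end IsPlainAspire

end HoLinks

theorem mainTheorem4 (c : HoLinks.TopCategory) {P : Type v} [PartialOrder P]
    {X : Type u} [TopologicalSpace X] (hX : c.IsObject X) (s : C(X, Topology.WithUpperSet P))
    {n : ℕ} (I : Fin (n + 1) ↪o P) (hR : HoLinks.AdmitsAspire c s I) :
    HoLinks.IsWeakHomotopyEquiv (HoLinks.HoLink.ev c s I) := by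
  obtain ⟨R, hR⟩ := hR.exists_isPlainAspire
  -- By definition `HoLink.ev` is `c.map` applied to `PlainHoLink.ev`.
  exact HoLinks.isWeakHomotopyEquiv_of_section c hR.ev_toSection hR.homotopicWith_section_comp_ev
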